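/- Let $n\ge 1$, $0<\beta<1$, $\ell>0$, $0<t_0\le T$. Write $x=(x_1,x')\in\mathbb R\times\mathbb R^{n-1}$, let $D'\subset\mathbb R^{n-1}$ be a bounded open set and $\Omega=(0,\ell)\times D'\subset\mathbb R^n$. Put $$\alpha(x,y)=\frac{y-x}{|y-x|^{n/2+\beta+1}},\qquad \mathcal D^*(w)(x,y)=-(w(y)-w(x))\,\alpha(x,y),\qquad x,y\in\mathbb R^n ,$$ and let $\mathcal D(\nu)(x)=\int_{\mathbb R^n}(\nu(x,y)+\nu(y,x))\cdot\alpha(x,y)\,dy$ and, for $x\in\mathbb R^n\setminus\Omega$, $\mathcal N(\nu)(x)=-\int_{\mathbb R^n}(\nu(x,y)+\nu(y,x))\cdot\alpha(x,y)\,dy$. Let $$H^\beta(\mathbb R^n)=\Big\{w\in L^2(\mathbb R^n):\ |w|_{H^\beta}^2=\int_{\mathbb R^n}\int_{\mathbb R^n}\frac{(w(y)-w(x))^2}{|y-x|^{n+2\beta}}\,dy\,dx<\infty\Big\},$$ with norm $(\|w\|_{L^2}^2+|w|_{H^\beta}^2)^{1/2}$, and let $H^\beta_c(\mathbb R^n)$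 be the set of those $w\in H^\beta(\mathbb R^n)$ that are integrable with $\int_{\mathbb R^n}w\,dx=0$. Let $f=f(x',t)$ be a measurable function on $D'\times(0,T)$, independent of $x_1$, and let $u$ be a weak solution of $$\begin{cases}\partial_t u+\mathcal D(\mathcal D^*u)=f(x',t) & \text{in }\Omega\times(0,T),\\ \mathcal N(\mathcal D^*u)=0 & \text{in }(\mathbb R^n\setminus\Omega)\times(0,T),\\ u(\cdot,0)=0 & \text{in }\mathbb R^n,\end{cases}$$ that is, $u(\cdot,0)=0$ and for every $\phi\in H^\beta_c(\mathbb R^n)$ and almost every $t\in(0,T)$ the function $x\mapsto f(x',t)\phi(x)$ is integrable on $\Omega$ and $$\int_\Omega \partial_tu\,\phi\,dx+\int_{\mathbb R^n}\int_{\mathbb R^n}\mathcal D^*(u)\cdot\mathcal D^*(\phi)\,dy\,dx=\int_\Omega f\,\phi\,dx .$$ Assume that $u$ and its weak derivative $\partial_{x_1}u$ on $\mathbb R^n$ both belong to $C([0,T];H^\beta(\mathbb R^n))\cap H^1(0,T;L^2(\Omega))$ (no zero-mean condition on $u$ is needed). If $u=0$ almost everywhere in $\mathbb R^n\setminus\Omega$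 for every $t\in(0,t_0)$, then $f(x',t)=0$ for almost every $(x',t)\in D'\times(0,t_0)$. -/

import Mathlib

open MeasureTheory Set Filter Topology
open scoped ENNReal ContDiff

noncomputable section

namespace NonlocalDiffusion

/-- Euclidean space `ℝⁿ`. -/
abbrev E (n : ℕ) : Type := EuclideanSpace ℝ (Fin n)

/-- The space `L²(ℝⁿ)`. -/
abbrev L2 (n : ℕ) : Type := Lp ℝ 2 (volume : Measure (E n))

/-- The space `L²(Ω)`. -/
abbrev L2On {n : ℕ} (Ω : Set (E n)) : Type := Lp ℝ 2 ((volume : Measure (E n)).restrict Ω)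

/-- Restriction `L²(ℝⁿ) → L²(Ω)`. -/
def restrictL2 {n : ℕ} (Ω : Set (E n)) (w : L2 n) : L2On Ω :=
  LpToLpRestrictCLM (E n) ℝ ℝ volume 2 Ω w

/-- The antisymmetric kernel `α(x,y) = (y - x) / |y - x|^{n/2 + β + 1}` for a constant order `β`
and infinite interaction radius. -/
def alpha {n : ℕ} (β : ℝ) (x y : E n) : E n :=
  (‖y - x‖ ^ ((n : ℝ) / 2 + β + 1))⁻¹ • (y - x)

/-- The adjoint `𝒟*` of the nonlocal divergence: `𝒟*(w)(x,y) = -(w(y) - w(x)) α(x,y)`. -/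
def Dstar {n : ℕ} (β : ℝ) (w : E n → ℝ) (x y : E n) : E n :=
  (-(w y - w x)) • alpha β x y

/-- The interaction domain `Ω_I`: the points outside `Ω` that interact with points of `Ω`. -/
def interactionDomain {n : ℕ} (β : ℝ) (Ω : Set (E n)) : Set (E n) :=
  {y | y ∉ Ω ∧ ∃ x ∈ Ω, alpha β x y ≠ 0}

/-- The interaction domain is the whole complement, so that `Ω ∪ Ω_I = ℝⁿ`. For this reason all
spaces and integrals over `Ω ∪ Ω_I` are taken over `ℝⁿ` below. -/
theorem interactionDomain_eq_compl {n : ℕ} (β : ℝ) {Ω : Set (E n)} (hΩ : Ω.Nonempty) :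
    interactionDomain β Ω = Ωᶜ := by
  ext y
  refine ⟨fun h => h.1, fun h => ⟨h, ?_⟩⟩
  obtain ⟨x, hx⟩ := hΩ
  have hne : y - x ≠ 0 := by
    intro h0
    rw [sub_eq_zero] at h0
    exact h (h0 ▸ hx)
  refine ⟨x, hx, smul_ne_zero (inv_ne_zero ?_) hne⟩
  exact (Real.rpow_pos_of_pos (norm_pos_iff.mpr hne) _).ne'

/-- The bilinear form `∫∫ 𝒟*(w) · 𝒟*(φ) dy dx` over `ℝⁿ × ℝⁿ` (with `a ≡ 1`). -/
def energyForm {n : ℕ} (β : ℝ) (w φ : E n → ℝ) : ℝ :=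
  ∫ x, ∫ y, inner ℝ (Dstar β w x y) (Dstar β φ x y)

/-- The squared seminorm of `H^β(ℝⁿ)`:
`∫∫ (w(y) - w(x))² / |y - x|^{n + 2β} dy dx`, which is also `∫∫ |𝒟*(w)|² dy dx`. -/
def seminormSq {n : ℕ} (β : ℝ) (w : E n → ℝ) : ℝ≥0∞ :=
  ∫⁻ x, ∫⁻ y, ENNReal.ofReal ((w y - w x) ^ 2 / ‖y - x‖ ^ ((n : ℝ) + 2 * β))

/-- Membership of an `L²` function in `H^β(ℝⁿ)`. -/
def MemH {n : ℕ} (β : ℝ) (w : L2 n) : Prop :=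
  seminormSq β w < ⊤

/-- Membership in the constrained space of the Neumann case, which is `V_c = H^β_c`: functions in
`H^β(ℝⁿ)` whose integral exists and vanishes. -/
def MemHc {n : ℕ} (β : ℝ) (w : L2 n) : Prop :=
  MemH β w ∧ Integrable w volume ∧ ∫ x, w x = 0

/-- `w ∈ C([0,T]; H^β(ℝⁿ))`. -/
def ContinuousInH {n : ℕ} (β T : ℝ) (w : ℝ → L2 n) : Prop :=
  (∀ t ∈ Icc 0 T, MemH β (w t)) ∧ ContinuousOn w (Icc 0 T) ∧
    ∀ t ∈ Icc 0 T, Tendsto (fun s => seminormSq β (w s - w t : L2 n)) (𝓝[Icc 0 T] t) (𝓝 0)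

/-- `w ∈ H¹(0,T; X)` with weak time derivative `w'`. -/
structure IsWeakTimeDeriv {X : Type*} [NormedAddCommGroup X] [NormedSpace ℝ X]
    (T : ℝ) (w w' : ℝ → X) : Prop where
  memLp : MemLp w 2 (volume.restrict (Ioo 0 T))
  memLp_deriv : MemLp w' 2 (volume.restrict (Ioo 0 T))
  integral_eq : ∀ η : ℝ → ℝ, ContDiff ℝ ∞ η → HasCompactSupport η → tsupport η ⊆ Ioo 0 T →
    ∫ t in Ioo 0 T, deriv η t • w t = -∫ t in Ioo 0 T, η t • w' t

/-- `v` is the weak partial derivative of `w` on `ℝⁿ` in the direction of the first coordinate. -/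
def IsWeakDerivFirst {m : ℕ} (w v : L2 (m + 1)) : Prop :=
  ∀ φ : E (m + 1) → ℝ, ContDiff ℝ ∞ φ → HasCompactSupport φ →
    ∫ x, w x * fderiv ℝ φ x (EuclideanSpace.single 0 1) = -∫ x, v x * φ x

/-- For `x = (x₁, x')`, the last coordinates `x'`. -/
def tailCoord {m : ℕ} (x : E (m + 1)) : E m :=
  WithLp.toLp 2 fun i => x i.succ

/-- The cylinder `(0,ℓ) × D'`. -/
def cylinder {m : ℕ} (ℓ : ℝ) (D : Set (E m)) : Set (E (m + 1)) :=
  {x | x 0 ∈ Ioo 0 ℓ ∧ tailCoord x ∈ D}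

/-- `u`, with time derivative `u'` on `Ω`, solves in the variational sense
`∂ₜu + 𝒟(𝒟*u) = f(x',t)` in `Ω × (0,T)`, `𝒩(𝒟*u) = 0` in `Ω_I × (0,T)`, `u(·,0) = 0`,
where `Ω = (0,ℓ) × D'`. The Neumann volume constraint is encoded in the fact that test functions
need not vanish outside `Ω`. -/
structure IsSolution {m : ℕ} (β ℓ T : ℝ) (D : Set (E m)) (f : E m → ℝ → ℝ)
    (u : ℝ → L2 (m + 1)) (u' : ℝ → L2On (cylinder ℓ D)) : Prop where
  initial : u 0 = 0
  variational : ∀ φ : L2 (m + 1), MemHc β φ → ∀ᵐ t ∂(volume.restrict (Ioo 0 T)),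
    IntegrableOn (fun x => f (tailCoord x) t * φ x) (cylinder ℓ D) ∧
    (∫ x in cylinder ℓ D, u' t x * φ x) + energyForm β (u t) φ
      = ∫ x in cylinder ℓ D, f (tailCoord x) t * φ x

end NonlocalDiffusion

end

/- The solution is shown to vanish by unique continuation: testing with functions supported outside
the cylinder, the Neumann constraint makes the potential of `u` of order `n + 2β` constant in the
exterior of a ball. Iterated Laplacians, the Weierstrass theorem and exponential moments then give
`u = 0` on `(0,t₀)`, and the equation tested inside the cylinder gives `f = 0`. The regularity of
the derivative in the first coordinate is not needed. -/

/-! The heart is a unique continuation property. If `u t` vanishes outside the bounded cylinder, a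
test function `φ` supported beyond a larger ball sees neither `f` nor `∂ₜu`, and in the energy only
the cross terms survive: the equation says that `φ` is orthogonal to the potential `∫ u(x) |y -
x|^{-n-2β} dx`. Since `φ` is only required to have mean zero, this potential is a constant outside
the ball, not necessarily zero (`exists_eq_const_of_integral_mul_eq_zero`).

The constant disappears under the Laplacian, which sends `|z|^{2b}` to a multiple of `|z|^{2(b-1)}`.
Iterating (`potential_sub_one_eq_zero`), all potentials with kernel `|y - x|^{2(b-1-k)}` vanish
there. For fixed `y` these are moments in `|y - x|^{-2}`; by Weierstrass approximation the Gaussian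
kernel may replace them, and moving `y` turns Gaussians into exponentials, which determine `u` by
Stone-Weierstrass (`ae_eq_zero_of_potential_const`).

With `u = 0`, also `∂ₜu = 0` on `(0,t₀)`, so `f` is orthogonal to every mean-zero test function. The
mean is corrected outside the cylinder, so all exponential moments of `f` vanish over the cylinder,
and hence `f = 0`. -/

noncomputable section

namespace NonlocalDiffusion

/-! ### Smooth mean-zero functions as admissible test functions -/

/-- The radial function dominating the Gagliardo integrand of a bounded Lipschitz function is
integrable. -/
theorem integrable_min_sq_div_rpow {n : ℕ} [NeZero n] {β : ℝ} (hβ₀ : 0 < β) (hβ₁ : β < 1)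
    {A B : ℝ} (hA : 0 ≤ A) (hB : 0 ≤ B) :
    Integrable (fun z : E n => min (A * ‖z‖ ^ 2) B / ‖z‖ ^ ((n : ℝ) + 2 * β)) := by
  have hn : 0 < n := Nat.pos_of_ne_zero (NeZero.ne n)
  have : Nontrivial (E n) := by
    have : Nonempty (Fin n) := ⟨⟨0, hn⟩⟩
    infer_instance
  refine (integrable_fun_norm_addHaar (E := E n) volume
    (f := fun r => min (A * r ^ 2) B / r ^ ((n : ℝ) + 2 * β))).2 ?_
  have hfr : Module.finrank ℝ (E n) = n := by simp
  rw [hfr]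
  have hmeas : Measurable fun r : ℝ =>
      r ^ (n - 1) • (min (A * r ^ 2) B / r ^ ((n : ℝ) + 2 * β)) := by
    simp only [smul_eq_mul]; fun_prop
  -- The polar weight `r^{n-1}` leaves `c r^{-1-2β}`. Near zero the numerator supplies `r²`, and
  -- `r^{1-2β}` is integrable as `β < 1`; at infinity `β > 0` suffices.
  have key : ∀ r : ℝ, 0 < r → ∀ c : ℝ, r ^ (n - 1) * (c / r ^ ((n : ℝ) + 2 * β))
      = c * r ^ (-1 - 2 * β) := by
    intro r hr c
    have h1 : (r ^ (n - 1) : ℝ) = r ^ ((n : ℝ) - 1) := by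
      rw [← Real.rpow_natCast, Nat.cast_sub hn, Nat.cast_one]
    rw [h1, div_eq_mul_inv, ← Real.rpow_neg hr.le, mul_left_comm, ← Real.rpow_add hr]
    congr 2; ring
  have hnn : ∀ r : ℝ, 0 ≤ min (A * r ^ 2) B := fun r => le_min (by positivity) hB
  rw [← Ioc_union_Ioi_eq_Ioi (zero_le_one' ℝ)]
  refine IntegrableOn.union ?_ ?_
  · have hint : IntegrableOn (fun r : ℝ => A * r ^ (1 - 2 * β)) (Ioc 0 1) := by
      refine Integrable.const_mul ?_ A
      have := intervalIntegral.intervalIntegrable_rpow' (a := 0) (b := 1) (r := 1 - 2 * β)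
        (by linarith)
      exact (intervalIntegrable_iff_integrableOn_Ioc_of_le zero_le_one).1 this
    refine Integrable.mono' hint hmeas.aestronglyMeasurable ?_
    filter_upwards [ae_restrict_mem measurableSet_Ioc] with r hr
    rw [smul_eq_mul, key r hr.1, Real.norm_of_nonneg
      (mul_nonneg (hnn r) (Real.rpow_nonneg hr.1.le _))]
    have h2 : r ^ (1 - 2 * β) = r ^ 2 * r ^ (-1 - 2 * β) := by
      rw [← Real.rpow_natCast, ← Real.rpow_add hr.1]; congr 1; push_cast; ring
    rw [h2, ← mul_assoc]
    exact mul_le_mul_of_nonneg_right (min_le_left _ _) (Real.rpow_nonneg hr.1.le _)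
  · have hint : IntegrableOn (fun r : ℝ => B * r ^ (-1 - 2 * β)) (Ioi 1) :=
      Integrable.const_mul (integrableOn_Ioi_rpow_of_lt (by linarith) one_pos) B
    refine Integrable.mono' hint hmeas.aestronglyMeasurable ?_
    filter_upwards [ae_restrict_mem measurableSet_Ioi] with r hr
    have hr0 : 0 < r := lt_trans one_pos hr
    rw [smul_eq_mul, key r hr0, Real.norm_of_nonneg
      (mul_nonneg (hnn r) (Real.rpow_nonneg hr0.le _))]
    exact mul_le_mul_of_nonneg_right (min_le_right _ _) (Real.rpow_nonneg hr0.le _)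

theorem seminormSq_congr {n : ℕ} {β : ℝ} {w w₁ : E n → ℝ} (h : w =ᵐ[volume] w₁) :
    seminormSq β w = seminormSq β w₁ := by
  refine lintegral_congr_ae ?_
  filter_upwards [h] with x hx
  refine lintegral_congr_ae ?_
  filter_upwards [h] with y hy
  rw [hx, hy]

theorem energyForm_congr {n : ℕ} {β : ℝ} {w w₁ φ φ₁ : E n → ℝ} (hw : w =ᵐ[volume] w₁)
    (hφ : φ =ᵐ[volume] φ₁) : energyForm β w φ = energyForm β w₁ φ₁ := by
  refine integral_congr_ae ?_
  filter_upwards [hw, hφ] with x hx hx'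
  refine integral_congr_ae ?_
  filter_upwards [hw, hφ] with y hy hy'
  simp only [Dstar, hx, hy, hx', hy']

theorem energyForm_zero_left {n : ℕ} {β : ℝ} (φ : E n → ℝ) : energyForm β 0 φ = 0 := by
  simp [energyForm, Dstar]

/-- Bounded Lipschitz functions with compact support have finite Gagliardo seminorm. -/
theorem seminormSq_lt_top_of_lipschitz {n : ℕ} [NeZero n] {β : ℝ} (hβ₀ : 0 < β) (hβ₁ : β < 1)
    {φ : E n → ℝ} {L : NNReal} (hL : LipschitzWith L φ) (hφ : HasCompactSupport φ) :
    seminormSq β φ < ⊤ := by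
  obtain ⟨M, hM⟩ := hL.continuous.bounded_above_of_compact_support hφ
  have hM0 : 0 ≤ M := (norm_nonneg _).trans (hM 0)
  set A : ℝ := (L : ℝ) ^ 2
  set B : ℝ := (2 * M) ^ 2
  set g : E n → ℝ≥0∞ := fun z => ENNReal.ofReal (min (A * ‖z‖ ^ 2) B / ‖z‖ ^ ((n : ℝ) + 2 * β))
    with hg
  have hgm : Measurable g := by rw [hg]; fun_prop
  have hgfin : ∫⁻ z, g z < ⊤ :=
    (integrable_min_sq_div_rpow hβ₀ hβ₁ (sq_nonneg _) (sq_nonneg _)).lintegral_lt_top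
  set S := tsupport φ
  have hS : MeasurableSet S := (isClosed_tsupport φ).measurableSet
  have hSfin : volume S < ⊤ := hφ.measure_lt_top
  -- The integrand is zero unless `x` or `y` lies in the support; translation invariance then bounds
  -- each term by `volume S * ∫ g`.
  have hbound : ∀ x y : E n, ENNReal.ofReal ((φ y - φ x) ^ 2 / ‖y - x‖ ^ ((n : ℝ) + 2 * β)) ≤
      S.indicator 1 x * g (y - x) + S.indicator 1 y * g (y - x) := by
    intro x y
    have h1 : ENNReal.ofReal ((φ y - φ x) ^ 2 / ‖y - x‖ ^ ((n : ℝ) + 2 * β)) ≤ g (y - x) := by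
      refine ENNReal.ofReal_le_ofReal ?_
      refine div_le_div_of_nonneg_right (le_min ?_ ?_) (Real.rpow_nonneg (norm_nonneg _) _)
      · have := hL.dist_le_mul y x
        rw [Real.dist_eq, dist_eq_norm] at this
        calc (φ y - φ x) ^ 2 = |φ y - φ x| ^ 2 := (sq_abs _).symm
          _ ≤ (L * ‖y - x‖) ^ 2 := by gcongr
          _ = A * ‖y - x‖ ^ 2 := by ring
      · have h1 := hM y
        have h2 := hM x
        rw [Real.norm_eq_abs] at h1 h2
        refine sq_le_sq' ?_ ?_ <;> linarith [abs_le.1 h1, abs_le.1 h2]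
    by_cases hx : x ∈ S
    · rw [indicator_of_mem hx]; simpa using h1.trans le_self_add
    by_cases hy : y ∈ S
    · rw [indicator_of_mem hy]; simpa using h1.trans le_add_self
    · have := image_eq_zero_of_notMem_tsupport hx
      have := image_eq_zero_of_notMem_tsupport hy
      simp [*]
  have hind : Measurable (S.indicator (1 : E n → ℝ≥0∞)) := measurable_one.indicator hS
  have hI : ∫⁻ x, S.indicator (1 : E n → ℝ≥0∞) x = volume S := by
    rw [lintegral_indicator_one hS]
  calc seminormSq β φ
      ≤ ∫⁻ x, ∫⁻ y, (S.indicator 1 x * g (y - x) + S.indicator 1 y * g (y - x)) :=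
        lintegral_mono fun x => lintegral_mono fun y => hbound x y
    _ = ∫⁻ x, ((∫⁻ y, S.indicator 1 x * g (y - x)) + ∫⁻ y, S.indicator 1 y * g (y - x)) := by
        refine lintegral_congr fun x => lintegral_add_left ?_ _
        fun_prop
    _ = (∫⁻ x, ∫⁻ y, S.indicator 1 x * g (y - x)) + ∫⁻ x, ∫⁻ y, S.indicator 1 y * g (y - x) := by
        refine lintegral_add_left ?_ _
        exact Measurable.lintegral_prod_right'
          (f := fun p : E n × E n => S.indicator 1 p.1 * g (p.2 - p.1)) (by fun_prop)
    _ = volume S * (∫⁻ z, g z) + volume S * ∫⁻ z, g z := by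
        congr 1
        · rw [← hI, ← lintegral_mul_const _ hind]
          refine lintegral_congr fun x => ?_
          rw [lintegral_const_mul _ (by fun_prop), lintegral_sub_right_eq_self g x]
        · rw [lintegral_lintegral_swap (by fun_prop), ← hI, ← lintegral_mul_const _ hind]
          refine lintegral_congr fun y => ?_
          rw [lintegral_const_mul _ (by fun_prop), lintegral_sub_left_eq_self g y]
    _ < ⊤ := by
        have := ENNReal.mul_lt_top hSfin hgfin
        exact ENNReal.add_lt_top.2 ⟨this, this⟩

/-- Smooth compactly supported functions with vanishing integral belong to `H^β_c`. -/
theorem memHc_toLp {n : ℕ} [NeZero n] {β : ℝ} (hβ₀ : 0 < β) (hβ₁ : β < 1) {φ : E n → ℝ}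
    (hφ : ContDiff ℝ ∞ φ) (hc : HasCompactSupport φ) (h0 : ∫ x, φ x = 0) :
    MemHc β ((hφ.continuous.memLp_of_hasCompactSupport hc : MemLp φ 2 volume).toLp φ) := by
  have hae := (hφ.continuous.memLp_of_hasCompactSupport hc : MemLp φ 2 volume).coeFn_toLp
  obtain ⟨L, hL⟩ := ContDiff.lipschitzWith_of_hasCompactSupport hc hφ (by simp)
  refine ⟨?_, ?_, ?_⟩
  · rw [MemH, seminormSq_congr hae]
    exact seminormSq_lt_top_of_lipschitz hβ₀ hβ₁ hL hc
  · exact (integrable_congr hae).2 (hφ.continuous.integrable_of_hasCompactSupport hc)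
  · rw [integral_congr_ae hae, h0]

/-! ### Energy of functions with separated supports, and potentials -/

theorem inner_Dstar {n : ℕ} {β : ℝ} (w φ : E n → ℝ) (x y : E n) :
    inner ℝ (Dstar β w x y) (Dstar β φ x y) =
      (w y - w x) * (φ y - φ x) * (‖y - x‖ ^ 2) ^ (-((n : ℝ) + 2 * β) / 2) := by
  rcases eq_or_ne y x with rfl | hne
  · simp [Dstar]
  have hr : 0 < ‖y - x‖ := norm_pos_iff.2 (sub_ne_zero.2 hne)
  -- Exponents: `2 - 2(n/2 + β + 1) = -(n + 2β)`. The power is taken of the squared norm because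
  -- that is what gets differentiated later.
  have h2 : (‖y - x‖ ^ 2) ^ (-((n : ℝ) + 2 * β) / 2) =
      (‖y - x‖ ^ ((n : ℝ) / 2 + β + 1))⁻¹ * (‖y - x‖ ^ ((n : ℝ) / 2 + β + 1))⁻¹ *
        ‖y - x‖ ^ 2 := by
    rw [← Real.rpow_neg hr.le, ← Real.rpow_natCast, ← Real.rpow_mul hr.le, ← Real.rpow_add hr,
      ← Real.rpow_add hr]
    congr 1; push_cast; ring
  rw [h2, Dstar, Dstar, alpha, inner_smul_left, inner_smul_right, inner_smul_left,
    inner_smul_right, real_inner_self_eq_norm_sq]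
  simp only [conj_trivial]
  ring

/-- The potential `∫ w(x) |y - x|^{2b} dx`. -/
def potential {n : ℕ} (b : ℝ) (w : E n → ℝ) (y : E n) : ℝ :=
  ∫ x, w x * (‖y - x‖ ^ 2) ^ b

/-- The gap of width one between the ball and the exterior region gives `|y - x| ≥ 1`, so the kernel
never meets its singularity. -/
theorem kernel_le_one {n : ℕ} {b R : ℝ} (hb : b ≤ 0) {x y : E n} (hx : ‖x‖ ≤ R)
    (hy : R + 1 ≤ ‖y‖) : (‖y - x‖ ^ 2) ^ b ≤ 1 := by
  have h1 : 1 ≤ ‖y - x‖ := by linarith [norm_sub_norm_le y x]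
  exact Real.rpow_le_one_of_one_le_of_nonpos (one_le_pow₀ h1) hb

theorem kernel_nonneg {n : ℕ} (b : ℝ) (z : E n) : 0 ≤ (‖z‖ ^ 2) ^ b :=
  Real.rpow_nonneg (sq_nonneg _) _

/-- The interaction density of two integrable functions with separated supports is integrable. -/
theorem integrable_mul_kernel {n : ℕ} {b R : ℝ} (hb : b ≤ 0) {w φ : E n → ℝ}
    (hw : Integrable w) (hφ : Integrable φ) (hwR : ∀ x, R < ‖x‖ → w x = 0)
    (hφR : ∀ y, ‖y‖ < R + 1 → φ y = 0) :
    Integrable (fun p : E n × E n => w p.1 * φ p.2 * (‖p.2 - p.1‖ ^ 2) ^ b)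
      (volume.prod volume) := by
  have h := hw.mul_prod hφ
  have hk : Measurable fun p : E n × E n => (‖p.2 - p.1‖ ^ 2) ^ b := by fun_prop
  refine h.mono (h.aestronglyMeasurable.mul hk.aestronglyMeasurable) (ae_of_all _ fun p => ?_)
  rw [norm_mul]
  by_cases hx : R < ‖p.1‖
  · simp [hwR _ hx]
  by_cases hy : ‖p.2‖ < R + 1
  · simp [hφR _ hy]
  rw [Real.norm_of_nonneg (kernel_nonneg b (p.2 - p.1))]
  exact mul_le_of_le_one_right (norm_nonneg _) (kernel_le_one hb (not_lt.1 hx) (not_lt.1 hy))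

/-- The energy form of two functions with separated supports. -/
theorem energyForm_eq_of_separated {n : ℕ} {β R : ℝ} (hβ : 0 < β) {w φ : E n → ℝ}
    (hw : Integrable w) (hφ : Integrable φ) (hwR : ∀ x, R < ‖x‖ → w x = 0)
    (hφR : ∀ y, ‖y‖ < R + 1 → φ y = 0) :
    energyForm β w φ = -2 * ∫ x, w x * potential (-((n : ℝ) + 2 * β) / 2) φ x := by
  set b := -((n : ℝ) + 2 * β) / 2 with hb
  have hb0 : b ≤ 0 := by
    have : (0 : ℝ) ≤ n := n.cast_nonneg
    rw [hb]; linarith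
  have hint := integrable_mul_kernel hb0 hw hφ hwR hφR
  -- The supports are disjoint, so the diagonal terms of the expanded product drop out and two cross
  -- terms remain, equal after swapping variables; hence the factor `-2`.
  have hprod : ∀ x, w x * φ x = 0 := by
    intro x
    by_cases hx : R < ‖x‖
    · simp [hwR _ hx]
    · simp [hφR x (by linarith)]
  have hpt : ∀ x y, inner ℝ (Dstar β w x y) (Dstar β φ x y) =
      -(w x * φ y * (‖y - x‖ ^ 2) ^ b) + -(w y * φ x * (‖x - y‖ ^ 2) ^ b) := by
    intro x y
    rw [inner_Dstar, norm_sub_rev x y]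
    linear_combination (hprod x + hprod y) * (‖y - x‖ ^ 2) ^ b
  have hsw : Integrable (fun p : E n × E n => w p.2 * φ p.1 * (‖p.1 - p.2‖ ^ 2) ^ b)
      (volume.prod volume) := hint.swap
  have e1 : ∫ p : E n × E n, w p.2 * φ p.1 * (‖p.1 - p.2‖ ^ 2) ^ b ∂(volume.prod volume) =
      ∫ p : E n × E n, w p.1 * φ p.2 * (‖p.2 - p.1‖ ^ 2) ^ b ∂(volume.prod volume) :=
    integral_prod_swap (fun p : E n × E n => w p.1 * φ p.2 * (‖p.2 - p.1‖ ^ 2) ^ b)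
  unfold energyForm
  simp only [hpt]
  have e2 : ∫ x, ∫ y, (-(w x * φ y * (‖y - x‖ ^ 2) ^ b) + -(w y * φ x * (‖x - y‖ ^ 2) ^ b)) =
      ∫ p : E n × E n, (-(w p.1 * φ p.2 * (‖p.2 - p.1‖ ^ 2) ^ b) +
        -(w p.2 * φ p.1 * (‖p.1 - p.2‖ ^ 2) ^ b)) ∂(volume.prod volume) :=
    (integral_prod _ (hint.neg.add hsw.neg)).symm
  simp only [← neg_add] at e2 ⊢
  rw [e2, integral_neg, integral_add hint hsw, e1, integral_prod _ hint]
  have : ∀ x, ∫ y, w x * φ y * (‖y - x‖ ^ 2) ^ b = w x * potential b φ x := by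
    intro x
    rw [potential, ← integral_const_mul]
    refine integral_congr_ae (ae_of_all _ fun y => ?_)
    simp only [norm_sub_rev x y]; ring
  simp only [this]
  ring

theorem integral_mul_potential_comm {n : ℕ} {b R : ℝ} (hb : b ≤ 0) {w φ : E n → ℝ}
    (hw : Integrable w) (hφ : Integrable φ) (hwR : ∀ x, R < ‖x‖ → w x = 0)
    (hφR : ∀ y, ‖y‖ < R + 1 → φ y = 0) :
    ∫ x, w x * potential b φ x = ∫ y, φ y * potential b w y := by
  have hint := integrable_mul_kernel hb hw hφ hwR hφR
  simp only [potential, ← integral_const_mul]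
  have e : ∫ x, ∫ y, w x * φ y * (‖y - x‖ ^ 2) ^ b = ∫ y, ∫ x, w x * φ y * (‖y - x‖ ^ 2) ^ b :=
    integral_integral_swap (f := fun x y => w x * φ y * (‖y - x‖ ^ 2) ^ b) hint
  have h1 : ∀ x y : E n, w x * (φ y * (‖x - y‖ ^ 2) ^ b) = w x * φ y * (‖y - x‖ ^ 2) ^ b :=
    fun x y => by rw [norm_sub_rev]; ring
  have h2 : ∀ x y : E n, φ y * (w x * (‖y - x‖ ^ 2) ^ b) = w x * φ y * (‖y - x‖ ^ 2) ^ b :=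
    fun x y => by ring
  simp only [h1, h2]
  exact e

theorem aestronglyMeasurable_potential {n : ℕ} {b : ℝ} {φ : E n → ℝ} (hφ : Continuous φ) :
    AEStronglyMeasurable (potential b φ) volume := by
  have : Measurable fun p : E n × E n => φ p.2 * (‖p.1 - p.2‖ ^ 2) ^ b := by fun_prop
  exact (this.stronglyMeasurable.integral_prod_right' (ν := volume)).aestronglyMeasurable

/-- Continuity lets almost-everywhere constancy of the potential become constancy at every exterior
point. -/
theorem continuousOn_potential {n : ℕ} {b R : ℝ} (hb : b ≤ 0) {w : E n → ℝ}
    (hw : Integrable w) (hwR : ∀ x, R < ‖x‖ → w x = 0) :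
    ContinuousOn (potential b w) {y | R + 1 < ‖y‖} := by
  refine continuousOn_of_dominated (bound := fun x => ‖w x‖) ?_ ?_ hw.norm ?_
  · intro y _
    have hk : Measurable fun x : E n => (‖y - x‖ ^ 2) ^ b := by fun_prop
    exact hw.aestronglyMeasurable.mul hk.aestronglyMeasurable
  · intro y hy
    refine ae_of_all _ fun x => ?_
    by_cases hx : R < ‖x‖
    · simp [hwR _ hx]
    rw [norm_mul, Real.norm_of_nonneg (kernel_nonneg b (y - x))]
    exact mul_le_of_le_one_right (norm_nonneg _) (kernel_le_one hb (not_lt.1 hx) (le_of_lt hy))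
  · refine ae_of_all _ fun x => ?_
    by_cases hx : R < ‖x‖
    · simpa [hwR _ hx] using continuousOn_const
    refine continuousOn_const.mul (ContinuousOn.rpow_const (by fun_prop) fun y hy => Or.inl ?_)
    have : 0 < ‖y - x‖ := by
      have : R + 1 < ‖y‖ := hy
      linarith [norm_sub_norm_le y x]
    positivity

/-! ### Orthogonality to mean-zero test functions -/

theorem exists_contDiff_integral_eq_one {n : ℕ} {U : Set (E n)} (hU : IsOpen U)
    (hne : U.Nonempty) : ∃ ψ : E n → ℝ, ContDiff ℝ ∞ ψ ∧ HasCompactSupport ψ ∧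
      tsupport ψ ⊆ U ∧ ∫ x, ψ x = 1 := by
  obtain ⟨c, hc⟩ := hne
  obtain ⟨ε, hε, hb⟩ := Metric.isOpen_iff.1 hU c hc
  let g : ContDiffBump c := ⟨ε / 4, ε / 2, by linarith, by linarith⟩
  refine ⟨g.normed volume, g.contDiff_normed, g.hasCompactSupport_normed, ?_, g.integral_normed⟩
  rw [g.tsupport_normed_eq]
  exact (Metric.closedBall_subset_ball (by simp only [g]; linarith)).trans hb

/-- A continuous function orthogonal to all test functions with vanishing integral is constant. -/
theorem exists_eq_const_of_integral_mul_eq_zero {n : ℕ} {U : Set (E n)} (hU : IsOpen U)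
    {G : E n → ℝ} (hG : ContinuousOn G U)
    (h : ∀ φ : E n → ℝ, ContDiff ℝ ∞ φ → HasCompactSupport φ → tsupport φ ⊆ U →
      ∫ x, φ x = 0 → ∫ x, φ x * G x = 0) : ∃ c, ∀ y ∈ U, G y = c := by
  rcases U.eq_empty_or_nonempty with rfl | hne
  · exact ⟨0, by simp⟩
  obtain ⟨ψ, hψ, hψc, hψU, hψ1⟩ := exists_contDiff_integral_eq_one hU hne
  set c := ∫ x, ψ x * G x
  have hint : ∀ φ : E n → ℝ, ContDiff ℝ ∞ φ → HasCompactSupport φ → tsupport φ ⊆ U →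
      Integrable (fun x => φ x * G x) := by
    intro φ hφ hφc hφU
    have hcont : Continuous fun x => φ x * G x := by
      refine continuous_iff_continuousAt.2 fun x => ?_
      by_cases hx : x ∈ tsupport φ
      · exact hφ.continuous.continuousAt.mul (hG.continuousAt (hU.mem_nhds (hφU hx)))
      · have : (fun x => φ x * G x) =ᶠ[𝓝 x] fun _ => 0 := by
          filter_upwards [(isClosed_tsupport φ).isOpen_compl.mem_nhds hx] with z hz
          rw [image_eq_zero_of_notMem_tsupport hz, zero_mul]
        exact continuousAt_const.congr this.symm
    exact hcont.integrable_of_hasCompactSupport hφc.mul_right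
  refine ⟨c, ?_⟩
  have hae := hU.ae_eq_zero_of_integral_contDiff_smul_eq_zero (f := fun x => G x - c)
    (μ := volume) ((hG.sub continuousOn_const).locallyIntegrableOn hU.measurableSet) (by
      intro φ hφ hφc hφU
      have hφi : Integrable φ := hφ.continuous.integrable_of_hasCompactSupport hφc
      have hψi : Integrable ψ := hψ.continuous.integrable_of_hasCompactSupport hψc
      have hψ' := hψc.mul_left (f := fun _ => ∫ x, φ x)
      -- Subtracting `(∫ φ) ψ` makes `φ` mean-zero; the resulting identity is `∫ φ (G - c) = 0`.
      have h0 := h (fun x => φ x - (∫ x, φ x) * ψ x) (hφ.sub (contDiff_const.mul hψ))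
        (hφc.sub hψ') ((tsupport_sub _ _).trans (union_subset hφU
          ((tsupport_mul_subset_right).trans hψU))) (by
            rw [integral_sub hφi (hψi.const_mul _), integral_const_mul, hψ1]; ring)
      have h1 : ∀ x, (φ x - (∫ x, φ x) * ψ x) * G x
          = φ x * G x - (∫ x, φ x) * (ψ x * G x) := fun x => by ring
      simp only [h1] at h0
      rw [integral_sub (hint φ hφ hφc hφU) ((hint ψ hψ hψc hψU).const_mul _),
        integral_const_mul] at h0
      simp only [smul_eq_mul, mul_sub]
      rw [integral_sub (hint φ hφ hφc hφU) (hφi.mul_const _), integral_mul_const]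
      exact h0)
  have := Measure.eqOn_open_of_ae_eq (μ := volume) (f := G) (g := fun _ => c) (U := U) (by
    rw [EventuallyEq, ae_restrict_iff' hU.measurableSet]
    filter_upwards [hae] with x hx hxU
    exact sub_eq_zero.1 (hx hxU)) hU hG continuousOn_const
  exact fun y hy => this hy

/-! ### Laplacians of potentials outside a ball -/

/-- Differentiation under the integral sign for a kernel that is smooth away from the origin:
if `∫ w(x) P(y - x) dx` is constant in the exterior of a ball, then its directional derivative
vanishes there. -/
theorem integral_mul_deriv_kernel_eq_zero {n : ℕ} {R c : ℝ} {w : E n → ℝ} (hw : Integrable w)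
    (hwR : ∀ x, R < ‖x‖ → w x = 0) {P P' : E n → ℝ} {e : E n} (hPm : Measurable P)
    (hP'm : Measurable P') (hP : ContinuousOn P {0}ᶜ) (hP' : ContinuousOn P' {0}ᶜ)
    (hd : ∀ z, z ≠ 0 → HasDerivAt (fun τ : ℝ => P (z + τ • e)) (P' z) 0)
    (hconst : ∀ y, R + 1 < ‖y‖ → ∫ x, w x * P (y - x) = c) {y : E n} (hy : R + 1 < ‖y‖) :
    ∫ x, w x * P' (y - x) = 0 := by
  have hline : Continuous fun τ : ℝ => y + τ • e := by fun_prop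
  have hopen : IsOpen {τ : ℝ | R + 1 < ‖y + τ • e‖} :=
    isOpen_lt continuous_const hline.norm
  obtain ⟨ε, hε, hball⟩ := Metric.isOpen_iff.1 hopen 0 (by simpa using hy)
  -- For `‖x‖ ≤ R` and `|τ| < ε`, the point `y + τ e - x` stays in the compact annulus `S` away from
  -- the origin, where `P` and `P'` are bounded.
  set ρ : ℝ := ‖y‖ + ε * ‖e‖ + R
  set S : Set (E n) := Metric.closedBall 0 ρ ∩ {z | 1 ≤ ‖z‖} with hS
  have hScomp : IsCompact S :=
    (isCompact_closedBall 0 ρ).inter_right (isClosed_le continuous_const continuous_norm)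
  have hS0 : S ⊆ {0}ᶜ := by
    rintro z ⟨-, hz⟩ h0
    rw [mem_singleton_iff] at h0
    simp only [h0, mem_ofPred_eq, norm_zero] at hz
    linarith
  have hmem : ∀ x, ‖x‖ ≤ R → ∀ τ ∈ Metric.ball (0 : ℝ) ε, y + τ • e - x ∈ S := by
    intro x hx τ hτ
    have h1 : R + 1 < ‖y + τ • e‖ := hball hτ
    have h2 : |τ| < ε := by simpa using hτ
    have h3 : ‖y + τ • e‖ ≤ ‖y‖ + ε * ‖e‖ := by
      refine (norm_add_le _ _).trans ?_
      rw [norm_smul, Real.norm_eq_abs]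
      gcongr
    refine ⟨?_, ?_⟩
    · rw [mem_closedBall_zero_iff]
      exact (norm_sub_le _ _).trans (add_le_add h3 hx)
    · rw [mem_ofPred_eq]
      linarith [norm_sub_norm_le (y + τ • e) x]
  obtain ⟨C, hC⟩ := hScomp.exists_bound_of_continuousOn (hP.mono hS0)
  obtain ⟨C', hC'⟩ := hScomp.exists_bound_of_continuousOn (hP'.mono hS0)
  have hmeas : ∀ Q : E n → ℝ, Measurable Q → ∀ τ : ℝ,
      AEStronglyMeasurable (fun x => w x * Q (y + τ • e - x)) volume := by
    intro Q hQ τ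
    refine hw.aestronglyMeasurable.mul (Measurable.aestronglyMeasurable ?_)
    fun_prop
  have hbd : ∀ (Q : E n → ℝ) (K : ℝ), (∀ z ∈ S, ‖Q z‖ ≤ K) → ∀ x,
      ∀ τ ∈ Metric.ball (0 : ℝ) ε, ‖w x * Q (y + τ • e - x)‖ ≤ ‖w x‖ * K := by
    intro Q K hQ x τ hτ
    by_cases hx : R < ‖x‖
    · simp [hwR x hx]
    rw [norm_mul]
    exact mul_le_mul_of_nonneg_left (hQ _ (hmem x (not_lt.1 hx) τ hτ)) (norm_nonneg _)
  have h0 : (0 : ℝ) ∈ Metric.ball (0 : ℝ) ε := Metric.mem_ball_self hε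
  have key := (hasDerivAt_integral_of_dominated_loc_of_deriv_le (μ := volume) (𝕜 := ℝ)
    (F := fun τ x => w x * P (y + τ • e - x)) (F' := fun τ x => w x * P' (y + τ • e - x))
    (x₀ := 0) (bound := fun x => ‖w x‖ * C') (Metric.ball_mem_nhds 0 hε)
    (Eventually.of_forall fun τ => hmeas P hPm τ)
    ((hw.norm.mul_const C).mono' (hmeas P hPm 0)
      (ae_of_all _ fun x => hbd P C hC x 0 h0))
    (hmeas P' hP'm 0) (ae_of_all _ fun x τ hτ => hbd P' C' hC' x τ hτ)
    (hw.norm.mul_const C') (ae_of_all _ fun x τ hτ => by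
      by_cases hx : R < ‖x‖
      · simpa [hwR x hx] using hasDerivAt_const τ (0 : ℝ)
      refine HasDerivAt.const_mul (w x) ?_
      have h1 := hd _ (hS0 (hmem x (not_lt.1 hx) τ hτ))
      -- `hd` differentiates only at parameter zero; a shift of the parameter gives the derivative
      -- at `τ`.
      have h2 := HasDerivAt.comp_sub_const (x := τ) (a := τ) (by simpa using h1)
      refine h2.congr_of_eventuallyEq (Eventually.of_forall fun σ => ?_)
      simp only
      congr 1
      module)).2
  have hc : HasDerivAt (fun τ : ℝ => ∫ x, w x * P (y + τ • e - x)) 0 0 := by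
    refine (hasDerivAt_const (0 : ℝ) c).congr_of_eventuallyEq ?_
    filter_upwards [Metric.ball_mem_nhds (0 : ℝ) hε] with τ hτ
    exact hconst _ (hball hτ)
  simpa using key.unique hc

theorem hasDerivAt_norm_sq_add_smul {n : ℕ} (z : E n) (i : Fin n) :
    HasDerivAt (fun τ : ℝ => ‖z + τ • EuclideanSpace.single i (1 : ℝ)‖ ^ 2) (2 * z i) 0 := by
  have h1 : HasDerivAt (fun τ : ℝ => z + τ • EuclideanSpace.single i (1 : ℝ))
      (EuclideanSpace.single i (1 : ℝ)) 0 := by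
    simpa using ((hasDerivAt_id (0 : ℝ)).smul_const
      (EuclideanSpace.single i (1 : ℝ) : E n)).const_add z
  have h2 := h1.norm_sq
  simpa [EuclideanSpace.inner_single_right] using h2

theorem hasDerivAt_rpow_norm_sq_add_smul {n : ℕ} (b : ℝ) {z : E n} (hz : z ≠ 0) (i : Fin n) :
    HasDerivAt (fun τ : ℝ => (‖z + τ • EuclideanSpace.single i (1 : ℝ)‖ ^ 2) ^ b)
      (2 * b * z i * (‖z‖ ^ 2) ^ (b - 1)) 0 := by
  have h := (hasDerivAt_norm_sq_add_smul z i).rpow_const (p := b)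
    (Or.inl (by simpa using hz))
  convert h using 1
  simp only [zero_smul, add_zero]
  ring

theorem continuousOn_rpow_norm_sq {n : ℕ} (b : ℝ) :
    ContinuousOn (fun z : E n => (‖z‖ ^ 2) ^ b) {0}ᶜ :=
  ContinuousOn.rpow_const (by fun_prop) fun z hz => Or.inl (by simpa using hz)

/-- If a Riesz-type potential is constant in the exterior of a ball, then so (in fact zero) is the
potential whose exponent is lowered by one, because it is a multiple of the Laplacian. -/
theorem potential_sub_one_eq_zero {n : ℕ} {R c b : ℝ} (hb : b < 0) (hbn : n + 2 * b - 2 ≠ 0)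
    {w : E n → ℝ} (hw : Integrable w) (hwR : ∀ x, R < ‖x‖ → w x = 0)
    (hconst : ∀ y, R + 1 < ‖y‖ → potential b w y = c) {y : E n} (hy : R + 1 < ‖y‖) :
    potential (b - 1) w y = 0 := by
  have hcoord : ∀ i : Fin n, ∀ y : E n, R + 1 < ‖y‖ →
      ∫ x, w x * ((y - x) i * (‖y - x‖ ^ 2) ^ (b - 1)) = 0 := by
    intro i y hy
    have h := integral_mul_deriv_kernel_eq_zero hw hwR
      (P := fun z => (‖z‖ ^ 2) ^ b) (P' := fun z => 2 * b * z i * (‖z‖ ^ 2) ^ (b - 1))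
      (e := EuclideanSpace.single i (1 : ℝ)) (by fun_prop) (by fun_prop)
      (continuousOn_rpow_norm_sq b)
      (ContinuousOn.mul (by fun_prop) (continuousOn_rpow_norm_sq (b - 1)))
      (fun z hz => hasDerivAt_rpow_norm_sq_add_smul b hz i) hconst hy
    have h' : ∀ x, w x * (2 * b * (y - x) i * (‖y - x‖ ^ 2) ^ (b - 1)) =
        2 * b * (w x * ((y - x) i * (‖y - x‖ ^ 2) ^ (b - 1))) := fun x => by ring
    simp only [h'] at h
    rw [integral_const_mul] at h
    exact (mul_eq_zero.1 h).resolve_left (by linarith)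
  have hsecond : ∀ i : Fin n, ∫ x, w x * ((‖y - x‖ ^ 2) ^ (b - 1) +
      (y - x) i * (2 * (b - 1) * (y - x) i * (‖y - x‖ ^ 2) ^ (b - 1 - 1))) = 0 := by
    intro i
    refine integral_mul_deriv_kernel_eq_zero hw hwR
      (P := fun z => z i * (‖z‖ ^ 2) ^ (b - 1)) (P' := fun z => (‖z‖ ^ 2) ^ (b - 1) +
        z i * (2 * (b - 1) * z i * (‖z‖ ^ 2) ^ (b - 1 - 1)))
      (e := EuclideanSpace.single i (1 : ℝ)) (by fun_prop) (by fun_prop)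
      (ContinuousOn.mul (by fun_prop) (continuousOn_rpow_norm_sq (b - 1)))
      ((continuousOn_rpow_norm_sq (b - 1)).add (ContinuousOn.mul (by fun_prop)
        (ContinuousOn.mul (by fun_prop) (continuousOn_rpow_norm_sq (b - 1 - 1)))))
      (fun z hz => ?_) (hcoord i) hy
    have h1 : HasDerivAt (fun τ : ℝ => (z + τ • EuclideanSpace.single i (1 : ℝ)) i) 1 0 := by
      simpa using (hasDerivAt_id (0 : ℝ)).const_add (z i)
    have h2 := h1.fun_mul (hasDerivAt_rpow_norm_sq_add_smul (b - 1) hz i)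
    simp only [zero_smul, add_zero, one_mul] at h2
    exact h2
  have hbdd : ∀ Q : E n → ℝ, Measurable Q → ContinuousOn Q {0}ᶜ →
      Integrable (fun x => w x * Q (y - x)) := by
    intro Q hQm hQ
    set S : Set (E n) := Metric.closedBall 0 (‖y‖ + R) ∩ {z | 1 ≤ ‖z‖} with hS
    have hScomp : IsCompact S := (isCompact_closedBall 0 _).inter_right
      (isClosed_le continuous_const continuous_norm)
    obtain ⟨C, hC⟩ := hScomp.exists_bound_of_continuousOn (hQ.mono (by
      rintro z ⟨-, hz⟩ h0
      rw [mem_singleton_iff] at h0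
      simp only [h0, mem_ofPred_eq, norm_zero] at hz
      linarith))
    refine (hw.norm.mul_const C).mono' (hw.aestronglyMeasurable.mul
      (Measurable.aestronglyMeasurable (by fun_prop))) (ae_of_all _ fun x => ?_)
    by_cases hx : R < ‖x‖
    · simp [hwR x hx]
    rw [norm_mul]
    refine mul_le_mul_of_nonneg_left (hC _ ⟨?_, ?_⟩) (norm_nonneg _)
    · rw [mem_closedBall_zero_iff]
      linarith [norm_sub_le y x]
    · rw [mem_ofPred_eq]
      linarith [norm_sub_norm_le y x]
  have hsum : ∑ i : Fin n, ∫ x, w x * ((‖y - x‖ ^ 2) ^ (b - 1) +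
      (y - x) i * (2 * (b - 1) * (y - x) i * (‖y - x‖ ^ 2) ^ (b - 1 - 1))) = 0 :=
    Finset.sum_eq_zero fun i _ => hsecond i
  rw [← integral_finsetSum _ fun i _ => hbdd (fun z => (‖z‖ ^ 2) ^ (b - 1) +
        z i * (2 * (b - 1) * z i * (‖z‖ ^ 2) ^ (b - 1 - 1))) (by fun_prop)
      ((continuousOn_rpow_norm_sq (b - 1)).add (ContinuousOn.mul (by fun_prop)
        (ContinuousOn.mul (by fun_prop) (continuousOn_rpow_norm_sq (b - 1 - 1)))))] at hsum
  -- Summing `|z|^{2(b-1)} + 2(b-1) zᵢ² |z|^{2(b-2)}` over `i` gives `(n + 2b - 2) |z|^{2(b-1)}`;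
  -- the factor `2b` of the Laplacian was divided out in `hcoord`.
  have hpt : ∀ x, ∑ i : Fin n, w x * ((‖y - x‖ ^ 2) ^ (b - 1) +
      (y - x) i * (2 * (b - 1) * (y - x) i * (‖y - x‖ ^ 2) ^ (b - 1 - 1))) =
      (n + 2 * b - 2) * (w x * (‖y - x‖ ^ 2) ^ (b - 1)) := by
    intro x
    by_cases hx : R < ‖x‖
    · simp [hwR x hx]
    have hpos : 0 < ‖y - x‖ ^ 2 := by
      have : 0 < ‖y - x‖ := by linarith [norm_sub_norm_le y x]
      positivity
    have hr : (‖y - x‖ ^ 2) ^ (b - 1) = ‖y - x‖ ^ 2 * (‖y - x‖ ^ 2) ^ (b - 1 - 1) := by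
      rw [Real.rpow_sub_one hpos.ne' (b - 1), mul_div_cancel₀ _ hpos.ne']
    have hn2 : ∑ i : Fin n, (y - x) i ^ 2 = ‖y - x‖ ^ 2 :=
      (EuclideanSpace.real_norm_sq_eq (y - x)).symm
    have : ∀ i : Fin n, w x * ((‖y - x‖ ^ 2) ^ (b - 1) +
      (y - x) i * (2 * (b - 1) * (y - x) i * (‖y - x‖ ^ 2) ^ (b - 1 - 1))) =
      w x * (‖y - x‖ ^ 2) ^ (b - 1) +
        (y - x) i ^ 2 * (w x * (2 * (b - 1)) * (‖y - x‖ ^ 2) ^ (b - 1 - 1)) := fun i => by ring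
    rw [Finset.sum_congr rfl fun i _ => this i, Finset.sum_add_distrib, Finset.sum_const,
      ← Finset.sum_mul, hn2, Finset.card_univ, Fintype.card_fin, nsmul_eq_mul, hr]
    ring
  simp only [hpt] at hsum
  rw [integral_const_mul] at hsum
  exact (mul_eq_zero.1 hsum).resolve_left hbn

/-! ### Moments, exponentials and unique continuation -/

/-- If all the integrals `∫ W ρᵏ` vanish, then so does `∫ W h(ρ)` for continuous `h`. -/
theorem integral_mul_comp_eq_zero {X : Type*} [MeasurableSpace X] {μ : Measure X} {W ρ : X → ℝ}
    {a c : ℝ} (hW : Integrable W μ) (hρm : AEStronglyMeasurable ρ μ)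
    (hρ : ∀ x, W x ≠ 0 → ρ x ∈ Icc a c)
    (h : ∀ k : ℕ, ∫ x, W x * ρ x ^ k ∂μ = 0) {g : ℝ → ℝ} (hg : ContinuousOn g (Icc a c)) :
    ∫ x, W x * g (ρ x) ∂μ = 0 := by
  by_cases hint : Integrable (fun x => W x * g (ρ x)) μ
  swap
  -- A nonintegrable function has integral zero by convention, so measurability of `g` need not be
  -- discussed.
  · exact integral_undef hint
  set M := max |a| |c|
  have hpow : ∀ k : ℕ, Integrable (fun x => W x * ρ x ^ k) μ := by
    intro k
    refine (hW.norm.mul_const (M ^ k)).mono' (hW.aestronglyMeasurable.mul (hρm.pow k))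
      (ae_of_all _ fun x => ?_)
    by_cases hx : W x = 0
    · simp [hx]
    rw [norm_mul, norm_pow]
    gcongr
    exact abs_le_max_abs_abs (hρ x hx).1 (hρ x hx).2
  have hpt : ∀ (p : Polynomial ℝ) (x : X), W x * p.eval (ρ x) =
      ∑ k ∈ Finset.range (p.natDegree + 1), p.coeff k * (W x * ρ x ^ k) := by
    intro p x
    rw [Polynomial.eval_eq_sum_range, Finset.mul_sum]
    exact Finset.sum_congr rfl fun k _ => by ring
  have hpint : ∀ p : Polynomial ℝ, Integrable (fun x => W x * p.eval (ρ x)) μ := by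
    intro p
    simp only [hpt]
    exact integrable_finsetSum _ fun k _ => (hpow k).const_mul _
  have hp0 : ∀ p : Polynomial ℝ, ∫ x, W x * p.eval (ρ x) ∂μ = 0 := by
    intro p
    simp only [hpt]
    rw [integral_finsetSum _ fun k _ => (hpow k).const_mul _]
    exact Finset.sum_eq_zero fun k _ => by rw [integral_const_mul, h k, mul_zero]
  have hle : ∀ ε > 0, ‖∫ x, W x * g (ρ x) ∂μ‖ ≤ ε * ∫ x, ‖W x‖ ∂μ := by
    intro ε hε
    obtain ⟨p, hp⟩ := exists_polynomial_near_of_continuousOn a c g hg ε hε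
    have : ∫ x, W x * g (ρ x) ∂μ = ∫ x, (W x * g (ρ x) - W x * p.eval (ρ x)) ∂μ := by
      rw [integral_sub hint (hpint p), hp0 p, sub_zero]
    rw [this, ← integral_const_mul]
    refine norm_integral_le_of_norm_le (hW.norm.const_mul ε) (ae_of_all _ fun x => ?_)
    by_cases hx : W x = 0
    · simp [hx]
    rw [← mul_sub, norm_mul, mul_comm, Real.norm_eq_abs, abs_sub_comm]
    exact mul_le_mul_of_nonneg_right (hp _ (hρ x hx)).le (norm_nonneg _)
  have hlim : Tendsto (fun ε : ℝ => ε * ∫ x, ‖W x‖ ∂μ) (𝓝[>] 0) (𝓝 0) := by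
    have : Tendsto (fun ε : ℝ => ε * ∫ x, ‖W x‖ ∂μ) (𝓝 0) (𝓝 (0 * ∫ x, ‖W x‖ ∂μ)) :=
      tendsto_id.mul_const _
    rw [zero_mul] at this
    exact this.mono_left nhdsWithin_le_nhds
  have := ge_of_tendsto hlim (eventually_mem_nhdsWithin.mono fun ε hε => hle ε hε)
  exact norm_le_zero_iff.1 this

/-- An integrable function with bounded support all of whose exponential moments vanish is
zero. -/
theorem ae_eq_zero_of_exp_moments {n : ℕ} {R : ℝ} {G : E n → ℝ} (hG : Integrable G)
    (hGR : ∀ x, R < ‖x‖ → G x = 0)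
    (h : ∀ k : Fin n → ℕ, ∫ x, G x * Real.exp (∑ i, k i * x i) = 0) : G =ᵐ[volume] 0 := by
  set K : Set (E n) := Metric.closedBall 0 R with hK
  have hKc : CompactSpace K := isCompact_iff_compactSpace.1 (isCompact_closedBall 0 R)
  have hKm : MeasurableSet K := Metric.isClosed_closedBall.measurableSet
  have hGK : ∀ x, x ∉ K → G x = 0 := by
    intro x hx
    exact hGR x (by simpa [hK] using hx)
  set μ : Measure K := (volume : Measure (E n)).comap Subtype.val
  have hint : ∀ F : E n → ℝ, ∫ x, G x * F x = ∫ x : K, G x * F x ∂μ := by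
    intro F
    rw [integral_subtype_comap hKm fun x => G x * F x,
      setIntegral_eq_integral_of_forall_compl_eq_zero]
    intro x hx
    rw [hGK x hx, zero_mul]
  have hGμ : Integrable (fun x : K => G x) μ :=
    (MeasurableEmbedding.subtype_coe hKm).integrable_map_iff.1 (by
      rw [(MeasurableEmbedding.subtype_coe hKm).map_comap, Subtype.range_coe]
      exact hG.integrableOn)
  have hgint : ∀ g : C(K, ℝ), Integrable (fun x : K => G x * g x) μ := by
    intro g
    refine (hGμ.norm.mul_const ‖g‖).mono' (hGμ.aestronglyMeasurable.mul
      g.continuous.aestronglyMeasurable) (ae_of_all _ fun x => ?_)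
    rw [norm_mul]
    exact mul_le_mul_of_nonneg_left (g.norm_coe_le_norm x) (norm_nonneg _)
  let Φ : C(K, ℝ) →ₗ[ℝ] ℝ :=
    { toFun := fun g => ∫ x : K, G x * g x ∂μ
      map_add' := fun g₁ g₂ => by
        simp only [ContinuousMap.add_apply, mul_add]
        exact integral_add (hgint g₁) (hgint g₂)
      map_smul' := fun a g => by
        simp only [ContinuousMap.smul_apply, smul_eq_mul, RingHom.id_apply]
        rw [← integral_const_mul]
        congr 1 with x
        ring }
  have hΦb : ∀ g, ‖Φ g‖ ≤ (∫ x : K, ‖G x‖ ∂μ) * ‖g‖ := by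
    intro g
    rw [← integral_mul_const]
    refine norm_integral_le_of_norm_le (hGμ.norm.mul_const _) (ae_of_all _ fun x => ?_)
    rw [norm_mul]
    exact mul_le_mul_of_nonneg_left (g.norm_coe_le_norm x) (norm_nonneg _)
  have hΦc : Continuous Φ := (Φ.mkContinuous _ hΦb).continuous
  -- Exponentials with natural frequencies are closed under multiplication, so their linear span is
  -- already the algebra that Stone-Weierstrass needs.
  let ex : Multiplicative (Fin n → ℕ) →* C(K, ℝ) :=
    { toFun := fun k => ⟨fun x => Real.exp (∑ i, (k.toAdd i : ℝ) * (x : E n) i), by fun_prop⟩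
      map_one' := by ext x; simp
      map_mul' := fun k l => by
        ext x
        simp [add_mul, Finset.sum_add_distrib, Real.exp_add] }
  let A : Subalgebra ℝ C(K, ℝ) := Algebra.adjoin ℝ (MonoidHom.mrange ex : Set C(K, ℝ))
  have hAΦ : ∀ g ∈ A, Φ g = 0 := by
    intro g hg
    have hg' : g ∈ Subalgebra.toSubmodule A := hg
    rw [Algebra.adjoin_eq_span, Submonoid.closure_eq] at hg'
    refine (Submodule.span_le (p := LinearMap.ker Φ)).2 ?_ hg'
    rintro _ ⟨k, rfl⟩
    change ∫ x : K, G x * Real.exp (∑ i, (k.toAdd i : ℝ) * (x : E n) i) ∂μ = 0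
    rw [← hint fun x => Real.exp (∑ i, (k.toAdd i : ℝ) * x i)]
    exact h k.toAdd
  have hsep : A.SeparatesPoints := by
    intro x y hxy
    obtain ⟨i, hi⟩ : ∃ i, (x : E n) i ≠ (y : E n) i := by
      by_contra! hcon
      exact hxy (Subtype.ext (PiLp.ext hcon))
    refine ⟨_, ⟨ex (Multiplicative.ofAdd (Pi.single i 1)),
      Algebra.subset_adjoin ⟨_, rfl⟩, rfl⟩, ?_⟩
    simp only [ex, MonoidHom.coe_mk, OneHom.coe_mk, ContinuousMap.coe_mk, toAdd_ofAdd, ne_eq,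
      Real.exp_eq_exp]
    simpa [Pi.single_apply] using hi
  have hall : ∀ g : C(K, ℝ), Φ g = 0 := by
    intro g
    have hg : g ∈ A.topologicalClosure := by
      rw [ContinuousMap.subalgebra_topologicalClosure_eq_top_of_separatesPoints A hsep]
      trivial
    have hcl : IsClosed {g | Φ g = 0} := isClosed_eq hΦc continuous_const
    exact closure_minimal (fun g hg => hAΦ g hg) hcl hg
  refine ae_eq_zero_of_integral_contDiff_smul_eq_zero hG.locallyIntegrable fun g hg _ => ?_
  simp only [smul_eq_mul, mul_comm (g _)]
  rw [hint g]
  exact hall ⟨fun x => g x, hg.continuous.comp continuous_subtype_val⟩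

/-- Unique continuation for Riesz-type potentials of order `n + 2β`: a function supported in a ball
whose potential is constant in the exterior of the ball vanishes. -/
theorem ae_eq_zero_of_potential_const {n : ℕ} [NeZero n] {β R c : ℝ} (hβ : 0 < β) (hR : 0 ≤ R)
    {w : E n → ℝ} (hw : Integrable w) (hwR : ∀ x, R < ‖x‖ → w x = 0)
    (hconst : ∀ y, R + 1 < ‖y‖ → potential (-((n : ℝ) + 2 * β) / 2) w y = c) :
    w =ᵐ[volume] 0 := by
  set b := -((n : ℝ) + 2 * β) / 2 with hb
  have hn0 : (0 : ℝ) ≤ n := n.cast_nonneg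
  -- The first descent removes the constant `c`. At exponent `b - j` the Laplacian factor is `-2β -
  -- 2j - 2 < 0`, so the descent never stalls.
  have hpot : ∀ k : ℕ, ∀ y, R + 1 < ‖y‖ → potential (b - 1 - k) w y = 0 := by
    intro k
    induction k with
    | zero =>
      intro y hy
      rw [Nat.cast_zero, sub_zero]
      exact potential_sub_one_eq_zero (by rw [hb]; linarith)
        (by rw [hb]; intro h; linarith) hw hwR hconst hy
    | succ k ih =>
      intro y hy
      have hk : (0 : ℝ) ≤ k := k.cast_nonneg
      have : b - 1 - ((k + 1 : ℕ) : ℝ) = b - 1 - k - 1 := by push_cast; ring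
      rw [this]
      exact potential_sub_one_eq_zero (by rw [hb]; linarith)
        (by rw [hb]; intro h; linarith) hw hwR ih hy
  have hgauss : ∀ y, R + 1 < ‖y‖ → ∫ x, w x * Real.exp (-‖y - x‖ ^ 2) = 0 := by
    intro y hy
    have hdist : ∀ x, w x ≠ 0 → 1 ≤ ‖y - x‖ ∧ ‖y - x‖ ≤ ‖y‖ + R := by
      intro x hx
      have hxR : ‖x‖ ≤ R := not_lt.1 fun h => hx (hwR x h)
      exact ⟨by linarith [norm_sub_norm_le y x], by linarith [norm_sub_le y x]⟩
    have hypos : 0 < ‖y‖ + R := by linarith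
    have hmk : Measurable fun x : E n => (‖y - x‖ ^ 2) ^ (b - 1) := by fun_prop
    have hW : Integrable fun x => w x * (‖y - x‖ ^ 2) ^ (b - 1) := by
      refine hw.mono (hw.aestronglyMeasurable.mul hmk.aestronglyMeasurable)
        (ae_of_all _ fun x => ?_)
      by_cases hx : w x = 0
      · simp [hx]
      rw [norm_mul, Real.norm_of_nonneg (kernel_nonneg _ (y - x))]
      exact mul_le_of_le_one_right (norm_nonneg _)
        (kernel_le_one (by rw [hb]; linarith) (not_lt.1 fun h => hx (hwR x h)) hy.le)
    -- With `r = |y - x|^{-2}`, the factor `r^{b-1}` cancels the weight in `W` and `exp(-1/r)` is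
    -- the Gaussian.
    have hg : ContinuousOn (fun r : ℝ => Real.exp (-r⁻¹) * r ^ (b - 1))
        (Icc (((‖y‖ + R) ^ 2)⁻¹) 1) := by
      have hne : ∀ r ∈ Icc (((‖y‖ + R) ^ 2)⁻¹) (1 : ℝ), r ≠ 0 := fun r hr =>
        (lt_of_lt_of_le (by positivity) hr.1).ne'
      exact (Real.continuous_exp.comp_continuousOn (continuousOn_id.inv₀ hne).neg).mul
        (continuousOn_id.rpow_const fun r hr => Or.inl (hne r hr))
    have key := integral_mul_comp_eq_zero (μ := volume)
      (W := fun x => w x * (‖y - x‖ ^ 2) ^ (b - 1)) (ρ := fun x => (‖y - x‖ ^ 2)⁻¹) hW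
      (Measurable.aestronglyMeasurable (by fun_prop)) (fun x hx => by
        obtain ⟨h1, h2⟩ := hdist x (left_ne_zero_of_mul hx)
        refine ⟨?_, inv_le_one_of_one_le₀ (one_le_pow₀ h1)⟩
        exact inv_anti₀ (by positivity) (by gcongr)) (fun k => by
        rw [← hpot k y hy, potential]
        congr 1 with x
        by_cases hx : w x = 0
        · simp [hx]
        have h1 : 0 < ‖y - x‖ ^ 2 := by
          have := (hdist x hx).1
          positivity
        rw [mul_assoc, Real.rpow_sub_natCast h1.ne' (b - 1) k, inv_pow, div_eq_mul_inv]) hg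
    rw [← key]
    congr 1 with x
    by_cases hx : w x = 0
    · simp [hx]
    have h1 : 0 < ‖y - x‖ ^ 2 := by
      have := (hdist x hx).1
      positivity
    rw [inv_inv, Real.inv_rpow h1.le]
    have := (Real.rpow_pos_of_pos h1 (b - 1)).ne'
    field_simp
  -- The centres `y` with `yᵢ = (K + kᵢ)/2` give `exp(2 y·x) = exp(∑ K xᵢ) exp(∑ kᵢ xᵢ)`. The offset
  -- `K` pushes each of them beyond radius `R + 1`, and its exponential is absorbed into the
  -- positive weight `q`.
  obtain ⟨K, hK⟩ := exists_nat_gt (2 * (R + 1))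
  have hKpos : (0 : ℝ) ≤ K := K.cast_nonneg
  set q : E n → ℝ := fun x => Real.exp (-‖x‖ ^ 2) * Real.exp (∑ i, (K : ℝ) * x i) with hq
  have hqc : Continuous q := by rw [hq]; fun_prop
  have hG : Integrable fun x => w x * q x := by
    obtain ⟨C, hC⟩ := (isCompact_closedBall (0 : E n) R).exists_bound_of_continuousOn
      hqc.continuousOn
    refine (hw.norm.mul_const C).mono' (hw.aestronglyMeasurable.mul hqc.aestronglyMeasurable)
      (ae_of_all _ fun x => ?_)
    by_cases hx : R < ‖x‖
    · simp [hwR x hx]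
    rw [norm_mul]
    exact mul_le_mul_of_nonneg_left (hC x (by simpa using hx)) (norm_nonneg _)
  have hmom := ae_eq_zero_of_exp_moments (R := R) hG (fun x hx => by rw [hwR x hx, zero_mul])
    (fun k => by
      set y : E n := WithLp.toLp 2 fun i => ((K : ℝ) + k i) / 2 with hy
      have hyn : R + 1 < ‖y‖ := by
        have h1 := PiLp.norm_apply_le y (0 : Fin n)
        have h2 : y 0 = ((K : ℝ) + k 0) / 2 := rfl
        have h3 : (0 : ℝ) ≤ k 0 := Nat.cast_nonneg _
        rw [h2, Real.norm_of_nonneg (by positivity)] at h1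
        linarith
      have h := hgauss y hyn
      have hpt : ∀ x, w x * Real.exp (-‖y - x‖ ^ 2) =
          Real.exp (-‖y‖ ^ 2) * (w x * q x * Real.exp (∑ i, k i * x i)) := by
        intro x
        have h1 : -‖y - x‖ ^ 2 = -‖y‖ ^ 2 + (-‖x‖ ^ 2 + ∑ i, (K : ℝ) * x i +
            ∑ i, (k i : ℝ) * x i) := by
          rw [norm_sub_sq_real, PiLp.inner_apply, add_assoc, ← Finset.sum_add_distrib]
          have : ∑ i, inner ℝ (y i) (x i) = (∑ i, ((K : ℝ) * x i + k i * x i)) / 2 := by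
            rw [Finset.sum_div]
            refine Finset.sum_congr rfl fun i _ => ?_
            simp only [hy, RCLike.inner_apply, conj_trivial]
            ring
          rw [this]
          ring
        rw [h1, Real.exp_add, Real.exp_add, Real.exp_add, hq]
        ring
      simp only [hpt] at h
      rw [integral_const_mul] at h
      exact (mul_eq_zero.1 h).resolve_left (Real.exp_ne_zero _))
  filter_upwards [hmom] with x hx
  have hqx : q x ≠ 0 := mul_ne_zero (Real.exp_ne_zero _) (Real.exp_ne_zero _)
  exact (mul_eq_zero.1 hx).resolve_right hqx

/-! ### Geometry and measure of the cylinder -/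

theorem continuous_tailCoord {m : ℕ} : Continuous (tailCoord : E (m + 1) → E m) := by
  unfold tailCoord
  fun_prop

theorem isOpen_cylinder {m : ℕ} (ℓ : ℝ) {D : Set (E m)} (hD : IsOpen D) :
    IsOpen (cylinder ℓ D) := by
  have h0 : Continuous fun x : E (m + 1) => x 0 := by fun_prop
  exact (isOpen_Ioo.preimage h0).inter (hD.preimage continuous_tailCoord)

theorem norm_sq_eq_tailCoord {m : ℕ} (x : E (m + 1)) : ‖x‖ ^ 2 = x 0 ^ 2 + ‖tailCoord x‖ ^ 2 := by
  rw [EuclideanSpace.real_norm_sq_eq, EuclideanSpace.real_norm_sq_eq, Fin.sum_univ_succ]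
  rfl

theorem exists_norm_le_of_mem_cylinder {m : ℕ} (ℓ : ℝ) {D : Set (E m)}
    (hD : Bornology.IsBounded D) : ∃ R, 0 ≤ R ∧ ∀ x ∈ cylinder ℓ D, ‖x‖ ≤ R := by
  obtain ⟨C, hC⟩ := hD.exists_norm_le
  refine ⟨|ℓ| + |C|, by positivity, fun x hx => ?_⟩
  obtain ⟨⟨h1, h2⟩, h3⟩ := hx
  have h4 : ‖tailCoord x‖ ≤ |C| := (hC _ h3).trans (le_abs_self C)
  have h5 : x 0 ≤ |ℓ| := h2.le.trans (le_abs_self ℓ)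
  refine le_of_sq_le_sq ?_ (by positivity)
  rw [norm_sq_eq_tailCoord]
  nlinarith [norm_nonneg (tailCoord x), abs_nonneg ℓ, abs_nonneg C]

/-- A set whose cylinder is null is null. -/
theorem volume_eq_zero_of_cylinder {m : ℕ} {ℓ : ℝ} (hℓ : 0 < ℓ) {N : Set (E m)}
    (h : volume (cylinder ℓ N) = 0) : volume N = 0 := by
  let e : E (m + 1) ≃ᵐ ℝ × E m :=
    (MeasurableEquiv.toLp 2 (Fin (m + 1) → ℝ)).symm.trans
      ((MeasurableEquiv.piFinSuccAbove (fun _ => ℝ) 0).trans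
        ((MeasurableEquiv.refl ℝ).prodCongr (MeasurableEquiv.toLp 2 (Fin m → ℝ))))
  have he : MeasurePreserving e volume (volume.prod volume) := by
    refine MeasurePreserving.trans
      (EuclideanSpace.volume_preserving_symm_measurableEquiv_toLp (Fin (m + 1))) ?_
    refine MeasurePreserving.trans (volume_preserving_piFinSuccAbove (fun _ => ℝ) 0) ?_
    exact (MeasurePreserving.id volume).prod (PiLp.volume_preserving_toLp (Fin m))
  have hpre : cylinder ℓ N = e ⁻¹' (Ioo 0 ℓ ×ˢ N) := rfl
  -- These identities hold for arbitrary sets, so `N` need not be measurable.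
  rw [hpre, he.measure_preimage_equiv, Measure.prod_prod, Real.volume_Ioo, mul_eq_zero] at h
  refine h.resolve_left ?_
  simpa using hℓ

/-! ### Vanishing of the solution -/

/-- Testing the variational equation with a smooth test function. -/
theorem IsSolution.test {m : ℕ} {β ℓ T : ℝ} {D : Set (E m)} {f : E m → ℝ → ℝ}
    {u : ℝ → L2 (m + 1)} {u' : ℝ → L2On (cylinder ℓ D)} (hsol : IsSolution β ℓ T D f u u')
    (hβ₀ : 0 < β) (hβ₁ : β < 1) {φ : E (m + 1) → ℝ} (hφ : ContDiff ℝ ∞ φ)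
    (hc : HasCompactSupport φ) (h0 : ∫ x, φ x = 0) :
    ∀ᵐ t ∂(volume.restrict (Ioo 0 T)),
      IntegrableOn (fun x => f (tailCoord x) t * φ x) (cylinder ℓ D) ∧
      (∫ x in cylinder ℓ D, u' t x * φ x) + energyForm β (u t) φ
        = ∫ x in cylinder ℓ D, f (tailCoord x) t * φ x := by
  have hae := (hφ.continuous.memLp_of_hasCompactSupport hc : MemLp φ 2 volume).coeFn_toLp
  filter_upwards [hsol.variational _ (memHc_toLp hβ₀ hβ₁ hφ hc h0)] with t ht
  have h1 : ∀ g : E (m + 1) → ℝ, (fun x => g x *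
      ((hφ.continuous.memLp_of_hasCompactSupport hc : MemLp φ 2 volume).toLp φ) x)
      =ᵐ[volume.restrict (cylinder ℓ D)] fun x => g x * φ x := by
    intro g
    filter_upwards [ae_restrict_of_ae hae] with x hx
    rw [hx]
  obtain ⟨h2, h3⟩ := ht
  refine ⟨(integrable_congr (h1 _)).1 h2, ?_⟩
  rw [integral_congr_ae (h1 _), integral_congr_ae (h1 _),
    energyForm_congr (EventuallyEq.refl _ _) hae] at h3
  exact h3

/-- Makes the potential of `φ`, cut off to the ball, an `L²` function, so that pairing it with `u t`
is continuous in time. -/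
theorem norm_potential_le {n : ℕ} {b R : ℝ} (hb : b ≤ 0) {φ : E n → ℝ} (hφ : Integrable φ)
    (hφR : ∀ y, ‖y‖ < R + 1 → φ y = 0) {x : E n} (hx : ‖x‖ ≤ R) :
    ‖potential b φ x‖ ≤ ∫ y, ‖φ y‖ := by
  refine norm_integral_le_of_norm_le hφ.norm (ae_of_all _ fun y => ?_)
  by_cases hy : ‖y‖ < R + 1
  · simp [hφR y hy]
  rw [norm_mul, Real.norm_of_nonneg (kernel_nonneg b (x - y)), norm_sub_rev]
  exact mul_le_of_le_one_right (norm_nonneg _) (kernel_le_one hb hx (not_lt.1 hy))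

theorem integrable_indicator_closedBall {n : ℕ} (R : ℝ) (w : L2 n) :
    Integrable ((Metric.closedBall (0 : E n) R).indicator w) := by
  rw [integrable_indicator_iff Metric.isClosed_closedBall.measurableSet]
  exact ((Lp.memLp w).locallyIntegrable one_le_two).integrableOn_isCompact
    (isCompact_closedBall 0 R)

/-- Supplies a representative vanishing everywhere outside the ball, as the lemmas on separated
supports demand. -/
theorem indicator_closedBall_ae_eq {n : ℕ} {R : ℝ} {Ω : Set (E n)} (hΩ : MeasurableSet Ω)
    (hΩR : ∀ x ∈ Ω, ‖x‖ ≤ R) {w : E n → ℝ} (hw : ∀ᵐ x ∂(volume.restrict Ωᶜ), w x = 0) :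
    (Metric.closedBall (0 : E n) R).indicator w =ᵐ[volume] w := by
  rw [ae_restrict_iff' hΩ.compl] at hw
  filter_upwards [hw] with x hx
  by_cases h : x ∈ Metric.closedBall (0 : E n) R
  · rw [indicator_of_mem h]
  · rw [indicator_of_notMem h, hx fun hxΩ => h (by simpa using hΩR x hxΩ)]

/-- If a solution vanishes outside the cylinder during `(0,t₀)`, the Neumann volume constraint
forces its potential to be orthogonal, at every such time, to all exterior test functions with
vanishing integral. -/
theorem IsSolution.integral_mul_potential_eq_zero {m : ℕ} {β ℓ T t₀ R : ℝ} {D : Set (E m)}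
    {f : E m → ℝ → ℝ} {u : ℝ → L2 (m + 1)} {u' : ℝ → L2On (cylinder ℓ D)}
    (hsol : IsSolution β ℓ T D f u u') (hβ₀ : 0 < β) (hβ₁ : β < 1) (ht₀T : t₀ ≤ T)
    (hDo : IsOpen D) (hΩR : ∀ x ∈ cylinder ℓ D, ‖x‖ ≤ R) (hcont : ContinuousOn u (Icc 0 T))
    (hvanish : ∀ t ∈ Ioo 0 t₀, ∀ᵐ x ∂(volume.restrict (cylinder ℓ D)ᶜ), u t x = 0)
    {φ : E (m + 1) → ℝ} (hφ : ContDiff ℝ ∞ φ) (hc : HasCompactSupport φ)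
    (hφR : ∀ y, ‖y‖ < R + 1 → φ y = 0) (h0 : ∫ x, φ x = 0) {t : ℝ} (ht : t ∈ Ioo 0 t₀) :
    ∫ y, φ y * potential (-(((m + 1 : ℕ) : ℝ) + 2 * β) / 2)
      ((Metric.closedBall (0 : E (m + 1)) R).indicator (u t)) y = 0 := by
  set b := -(((m + 1 : ℕ) : ℝ) + 2 * β) / 2 with hb
  have hb0 : b ≤ 0 := by
    have : (0 : ℝ) ≤ (m + 1 : ℕ) := Nat.cast_nonneg _
    rw [hb]; linarith
  set K := Metric.closedBall (0 : E (m + 1)) R with hK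
  have hKm : MeasurableSet K := Metric.isClosed_closedBall.measurableSet
  have hφi : Integrable φ := hφ.continuous.integrable_of_hasCompactSupport hc
  have hWi : ∀ t, Integrable (K.indicator (u t)) := fun t => integrable_indicator_closedBall R _
  have hW0 : ∀ t, ∀ x, R < ‖x‖ → K.indicator (u t) x = 0 := fun t x hx =>
    indicator_of_notMem (by simpa [hK] using hx) _
  have hΩm := (isOpen_cylinder ℓ hDo).measurableSet
  have hkL : MemLp (K.indicator (potential b φ)) 2 volume := by
    rw [memLp_indicator_iff_restrict hKm]
    have : IsFiniteMeasure ((volume : Measure (E (m + 1))).restrict K) :=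
      isFiniteMeasure_restrict.2 (isCompact_closedBall 0 R).measure_lt_top.ne
    refine MemLp.of_bound (aestronglyMeasurable_potential hφ.continuous).restrict
      (∫ y, ‖φ y‖) ?_
    filter_upwards [ae_restrict_mem hKm] with x hx
    exact norm_potential_le hb0 hφi hφR (by simpa [hK] using hx)
  have hinner : ∀ t, inner ℝ (hkL.toLp _) (u t) = ∫ x, K.indicator (u t) x * potential b φ x := by
    intro t
    rw [L2.inner_def]
    refine integral_congr_ae ?_
    filter_upwards [hkL.coeFn_toLp] with x hx
    rw [hx]
    by_cases h : x ∈ K <;> simp [h]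
  -- The exceptional set of times in the weak formulation depends on `φ`. Continuity in time removes
  -- it, so that `t` can be fixed while `φ` varies.
  have hΦc : ContinuousOn (fun t => inner ℝ (hkL.toLp _) (u t)) (Ioo 0 t₀) :=
    (continuousOn_const.inner hcont).mono
      (Ioo_subset_Icc_self.trans (Icc_subset_Icc_right ht₀T))
  have hae : (fun t => inner ℝ (hkL.toLp _) (u t)) =ᵐ[volume.restrict (Ioo 0 t₀)]
      fun _ => (0 : ℝ) := by
    have htest := ae_restrict_of_ae_restrict_of_subset (Ioo_subset_Ioo_right ht₀T)
      (hsol.test hβ₀ hβ₁ hφ hc h0)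
    filter_upwards [htest, ae_restrict_mem measurableSet_Ioo] with s hs hst
    have hz : ∀ g : E (m + 1) → ℝ, ∫ x in cylinder ℓ D, g x * φ x = 0 := by
      intro g
      refine setIntegral_eq_zero_of_forall_eq_zero fun x hx => ?_
      rw [hφR x (by linarith [hΩR x hx]), mul_zero]
    have h1 := hs.2
    rw [hz, hz, zero_add, energyForm_congr
      (indicator_closedBall_ae_eq hΩm hΩR (hvanish s hst)).symm (EventuallyEq.refl _ _),
      energyForm_eq_of_separated hβ₀ (hWi s) hφi (hW0 s) hφR] at h1
    change inner ℝ (hkL.toLp _) (u s) = (0 : ℝ)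
    rw [hinner s]
    exact (mul_eq_zero.1 h1).resolve_left (by norm_num)
  have hall := Measure.eqOn_open_of_ae_eq hae isOpen_Ioo hΦc continuousOn_const ht
  rw [← integral_mul_potential_comm hb0 (hWi t) hφi (hW0 t) hφR, ← hinner t]
  exact hall

/-- A solution that vanishes outside the cylinder during `(0,t₀)` vanishes identically there. -/
theorem IsSolution.eq_zero {m : ℕ} {β ℓ T t₀ R : ℝ} {D : Set (E m)}
    {f : E m → ℝ → ℝ} {u : ℝ → L2 (m + 1)} {u' : ℝ → L2On (cylinder ℓ D)}
    (hsol : IsSolution β ℓ T D f u u') (hβ₀ : 0 < β) (hβ₁ : β < 1) (ht₀T : t₀ ≤ T)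
    (hDo : IsOpen D) (hR : 0 ≤ R) (hΩR : ∀ x ∈ cylinder ℓ D, ‖x‖ ≤ R)
    (hcont : ContinuousOn u (Icc 0 T))
    (hvanish : ∀ t ∈ Ioo 0 t₀, ∀ᵐ x ∂(volume.restrict (cylinder ℓ D)ᶜ), u t x = 0)
    {t : ℝ} (ht : t ∈ Ioo 0 t₀) : u t = 0 := by
  have hb0 : -(((m + 1 : ℕ) : ℝ) + 2 * β) / 2 ≤ 0 := by
    have : (0 : ℝ) ≤ (m + 1 : ℕ) := Nat.cast_nonneg _
    linarith
  have hWi := integrable_indicator_closedBall R (u t)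
  have hW0 : ∀ x, R < ‖x‖ → (Metric.closedBall (0 : E (m + 1)) R).indicator (u t) x = 0 :=
    fun x hx => indicator_of_notMem (by simpa using hx) _
  have hU : IsOpen {y : E (m + 1) | R + 1 < ‖y‖} := isOpen_lt continuous_const continuous_norm
  obtain ⟨c, hconst⟩ := exists_eq_const_of_integral_mul_eq_zero hU
    (continuousOn_potential hb0 hWi hW0) fun φ hφ hc hφU h0 =>
      hsol.integral_mul_potential_eq_zero hβ₀ hβ₁ ht₀T hDo hΩR hcont hvanish hφ hc
        (fun y hy => image_eq_zero_of_notMem_tsupport fun hmem =>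
          (lt_asymm hy (mem_ofPred.1 (hφU hmem)))) h0 ht
  have hzero := ae_eq_zero_of_potential_const hβ₀ hR hWi hW0 hconst
  have hu := indicator_closedBall_ae_eq (isOpen_cylinder ℓ hDo).measurableSet hΩR (hvanish t ht)
  exact (Lp.eq_zero_iff_ae_eq_zero).2 (hu.symm.trans hzero)

/-! ### Recovering the source -/

/-- The weak time derivative of a function vanishing on `(0,t₀)` vanishes there. -/
theorem IsWeakTimeDeriv.ae_eq_zero {X : Type*} [NormedAddCommGroup X] [NormedSpace ℝ X]
    [CompleteSpace X] {T t₀ : ℝ} {w w' : ℝ → X} (h : IsWeakTimeDeriv T w w') (ht₀T : t₀ ≤ T)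
    (hw : ∀ t ∈ Ioo 0 t₀, w t = 0) : ∀ᵐ t ∂(volume.restrict (Ioo 0 t₀)), w' t = 0 := by
  have hsub : Ioo 0 t₀ ⊆ Ioo 0 T := Ioo_subset_Ioo_right ht₀T
  have hint : IntegrableOn w' (Ioo 0 T) := h.memLp_deriv.integrable one_le_two
  rw [ae_restrict_iff' measurableSet_Ioo]
  refine isOpen_Ioo.ae_eq_zero_of_integral_contDiff_smul_eq_zero
    (hint.mono_set hsub).locallyIntegrableOn fun η hη hηc hηs => ?_
  have h1 := h.integral_eq η hη hηc (hηs.trans hsub)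
  have h2 : ∫ t in Ioo 0 T, deriv η t • w t = 0 := by
    refine setIntegral_eq_zero_of_forall_eq_zero fun t _ => ?_
    by_cases ht : t ∈ Ioo 0 t₀
    · rw [hw t ht, smul_zero]
    · have : deriv η t = 0 :=
        image_eq_zero_of_notMem_tsupport fun hm => ht (hηs (tsupport_deriv_subset hm))
      rw [this, zero_smul]
  have h3 : ∫ t in Ioo 0 T, η t • w' t = ∫ t, η t • w' t := by
    refine setIntegral_eq_integral_of_forall_compl_eq_zero fun t ht => ?_
    rw [image_eq_zero_of_notMem_tsupport fun hm => ht (hsub (hηs hm)), zero_smul]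
  rw [h2, h3] at h1
  exact neg_eq_zero.1 h1.symm

/-- A source term orthogonal to all admissible test functions vanishes. -/
theorem ae_ae_eq_zero_of_test {m : ℕ} {ℓ R : ℝ} {D : Set (E m)} {I : Set ℝ}
    {f : E m → ℝ → ℝ} (hℓ : 0 < ℓ) (hDo : IsOpen D) (hΩR : ∀ x ∈ cylinder ℓ D, ‖x‖ ≤ R)
    (hR : 0 ≤ R)
    (htest : ∀ φ : E (m + 1) → ℝ, ContDiff ℝ ∞ φ → HasCompactSupport φ → ∫ x, φ x = 0 →
      ∀ᵐ t ∂(volume.restrict I), IntegrableOn (fun x => f (tailCoord x) t * φ x) (cylinder ℓ D) ∧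
        ∫ x in cylinder ℓ D, f (tailCoord x) t * φ x = 0) :
    ∀ᵐ t ∂(volume.restrict I), ∀ᵐ x ∂(volume.restrict D), f x t = 0 := by
  have hΩm := (isOpen_cylinder ℓ hDo).measurableSet
  have hU : IsOpen {y : E (m + 1) | R + 1 < ‖y‖} := isOpen_lt continuous_const continuous_norm
  -- `χ` makes exponentials compactly supported and equals one on the cylinder; `ψ`, supported
  -- outside the ball, restores mean zero without being seen there.
  obtain ⟨ψ, hψ, hψc, hψU, hψ1⟩ := exists_contDiff_integral_eq_one hU (by
    obtain ⟨y, hy⟩ := NormedSpace.exists_lt_norm ℝ (E (m + 1)) (R + 1)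
    exact ⟨y, hy⟩)
  let χ : ContDiffBump (0 : E (m + 1)) := ⟨R + 1, R + 2, by linarith, by linarith⟩
  have hχ1 : ∀ x ∈ cylinder ℓ D, χ x = 1 := fun x hx =>
    χ.one_of_mem_closedBall (by
      have := hΩR x hx
      simp only [χ, mem_closedBall_zero_iff]
      linarith)
  have hψ0 : ∀ x ∈ cylinder ℓ D, ψ x = 0 := fun x hx =>
    image_eq_zero_of_notMem_tsupport fun hm => by
      have h1 := mem_ofPred.1 (hψU hm)
      linarith [hΩR x hx]
  let e : (Fin (m + 1) → ℕ) → E (m + 1) → ℝ := fun k x => Real.exp (∑ i, k i * x i)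
  have hmom : ∀ k : Fin (m + 1) → ℕ, ∀ᵐ t ∂(volume.restrict I),
      IntegrableOn (fun x => f (tailCoord x) t * e k x) (cylinder ℓ D) ∧
        ∫ x in cylinder ℓ D, f (tailCoord x) t * e k x = 0 := by
    intro k
    have he : ContDiff ℝ ∞ fun x => χ x * e k x := χ.contDiff.mul (by fun_prop)
    have hec : HasCompactSupport fun x => χ x * e k x := χ.hasCompactSupport.mul_right
    have hei : Integrable fun x => χ x * e k x :=
      he.continuous.integrable_of_hasCompactSupport hec
    have hψi : Integrable ψ := hψ.continuous.integrable_of_hasCompactSupport hψc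
    set c := ∫ x, χ x * e k x
    filter_upwards [htest (fun x => χ x * e k x - c * ψ x) (he.sub (contDiff_const.mul hψ))
      (hec.sub (hψc.mul_left (f := fun _ => c))) (by
        rw [integral_sub hei (hψi.const_mul c), integral_const_mul, hψ1]
        simp [c])] with t ht
    have hcongr : ∀ x ∈ cylinder ℓ D, f (tailCoord x) t * (χ x * e k x - c * ψ x) =
        f (tailCoord x) t * e k x := fun x hx => by
      rw [hχ1 x hx, hψ0 x hx]
      ring
    rw [setIntegral_congr_fun hΩm hcongr, integrableOn_congr_fun hcongr hΩm] at ht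
    exact ht
  -- The multi-indices are countable, so one null set of times serves for all moments; `k = 0` gives
  -- integrability.
  filter_upwards [ae_all_iff.2 hmom] with t ht
  have hint : IntegrableOn (fun x => f (tailCoord x) t) (cylinder ℓ D) := by
    simpa [e] using (ht 0).1
  have hzero := ae_eq_zero_of_exp_moments (R := R)
    (G := (cylinder ℓ D).indicator fun x => f (tailCoord x) t)
    ((integrable_indicator_iff hΩm).2 hint)
    (fun x hx => indicator_of_notMem (fun hxΩ => by linarith [hΩR x hxΩ]) _) (fun k => by
      rw [← (ht k).2, ← integral_indicator hΩm]
      congr 1 with x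
      rw [indicator_mul_left])
  rw [ae_restrict_iff' hDo.measurableSet, ae_iff]
  refine volume_eq_zero_of_cylinder hℓ (measure_mono_null ?_ (ae_iff.1 hzero))
  rintro x ⟨hx0, hxN⟩
  rw [mem_ofPred, Classical.not_imp] at hxN
  rw [mem_ofPred, indicator_of_mem (show x ∈ cylinder ℓ D from ⟨hx0, hxN.1⟩)]
  exact hxN.2

end NonlocalDiffusion

end


/-! ### Conclusion on the product domain -/

theorem theorem4p2 {m : ℕ} (β ℓ T t₀ : ℝ) (hβ₀ : 0 < β) (hβ₁ : β < 1) (hℓ : 0 < ℓ)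
    (ht₀ : 0 < t₀) (ht₀T : t₀ ≤ T)
    (D : Set (NonlocalDiffusion.E m)) (hDo : IsOpen D) (hDb : Bornology.IsBounded D)
    (f : NonlocalDiffusion.E m → ℝ → ℝ)
    (hf : AEStronglyMeasurable (fun p : NonlocalDiffusion.E m × ℝ => f p.1 p.2)
      ((volume.restrict D).prod (volume.restrict (Ioo 0 T))))
    (u v : ℝ → NonlocalDiffusion.L2 (m + 1))
    (u' v' : ℝ → NonlocalDiffusion.L2On (NonlocalDiffusion.cylinder ℓ D))
    (hv : ∀ t ∈ Icc 0 T, NonlocalDiffusion.IsWeakDerivFirst (u t) (v t))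
    (hu_cont : NonlocalDiffusion.ContinuousInH β T u)
    (hv_cont : NonlocalDiffusion.ContinuousInH β T v)
    (hu_time : NonlocalDiffusion.IsWeakTimeDeriv T
      (fun t => NonlocalDiffusion.restrictL2 (NonlocalDiffusion.cylinder ℓ D) (u t)) u')
    (hv_time : NonlocalDiffusion.IsWeakTimeDeriv T
      (fun t => NonlocalDiffusion.restrictL2 (NonlocalDiffusion.cylinder ℓ D) (v t)) v')
    (hsol : NonlocalDiffusion.IsSolution β ℓ T D f u u')
    (hvanish : ∀ t ∈ Ioo 0 t₀,
      ∀ᵐ x ∂(volume.restrict (NonlocalDiffusion.cylinder ℓ D)ᶜ), u t x = 0) :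
    ∀ᵐ p ∂((volume.restrict D).prod (volume.restrict (Ioo 0 t₀))), f p.1 p.2 = 0 := by

  obtain ⟨R, hR, hΩR⟩ := NonlocalDiffusion.exists_norm_le_of_mem_cylinder ℓ hDb
  have hzero : ∀ t ∈ Ioo 0 t₀, u t = 0 := fun t ht =>
    hsol.eq_zero hβ₀ hβ₁ ht₀T hDo hR hΩR hu_cont.2.1 hvanish ht
  have hu'zero := hu_time.ae_eq_zero ht₀T fun t ht => by
    rw [hzero t ht, NonlocalDiffusion.restrictL2, map_zero]
  have hslice := NonlocalDiffusion.ae_ae_eq_zero_of_test (I := Ioo 0 t₀) (f := f) hℓ hDo hΩR hR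
    fun φ hφ hc h0 => by
      have htest := ae_restrict_of_ae_restrict_of_subset (Ioo_subset_Ioo_right ht₀T)
        (hsol.test hβ₀ hβ₁ hφ hc h0)
      filter_upwards [htest, hu'zero, ae_restrict_mem measurableSet_Ioo] with t ht hut htI
      refine ⟨ht.1, ?_⟩
      have h1 : ∫ x in NonlocalDiffusion.cylinder ℓ D, u' t x * φ x = 0 := by
        refine integral_eq_zero_of_ae ?_
        rw [hut]
        filter_upwards [Lp.coeFn_zero ℝ 2 (volume.restrict (NonlocalDiffusion.cylinder ℓ D))]
          with x hx
        change _ * φ x = 0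
        rw [hx, Pi.zero_apply, zero_mul]
      have h2 : NonlocalDiffusion.energyForm β (u t) φ = 0 := by
        rw [hzero t htI, NonlocalDiffusion.energyForm_congr (Lp.coeFn_zero ℝ 2 volume)
          (EventuallyEq.refl _ φ)]
        exact NonlocalDiffusion.energyForm_zero_left φ
      rw [← ht.2, h1, h2, add_zero]
  have hf₀ : AEStronglyMeasurable (fun p : NonlocalDiffusion.E m × ℝ => f p.1 p.2)
      ((volume.restrict D).prod (volume.restrict (Ioo 0 t₀))) :=
    hf.mono_measure (Measure.prod_mono le_rfl
      (Measure.restrict_mono (Ioo_subset_Ioo_right ht₀T) le_rfl))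
  -- Passing from slices to the product needs a measurable zero set, hence a measurable
  -- representative of `f`.
  have hg := hf₀.stronglyMeasurable_mk
  have hfg := hf₀.ae_eq_mk
  set g := hf₀.mk
  have hgset : MeasurableSet {p : NonlocalDiffusion.E m × ℝ | g p = 0} :=
    hg.measurable (measurableSet_singleton 0)
  have hg0 : ∀ᵐ t ∂(volume.restrict (Ioo 0 t₀)), ∀ᵐ x ∂(volume.restrict D), g (x, t) = 0 := by
    have hsw := Measure.ae_ae_of_ae_prod
      (Measure.measurePreserving_swap.quasiMeasurePreserving.ae hfg)
    filter_upwards [hslice, hsw] with t h1 h2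
    filter_upwards [h1, h2] with x h3 h4
    exact h4.symm.trans h3
  have hg1 : ∀ᵐ p ∂((volume.restrict D).prod (volume.restrict (Ioo 0 t₀))), g p = 0 :=
    (Measure.ae_prod_iff_ae_ae hgset).2 ((Measure.ae_ae_comm hgset).2 hg0)
  filter_upwards [hfg, hg1] with p h1 h2
  exact h1.trans h2
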